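/- Let $N\ge 1$, $0\le M\le N$ and $n\ge 0$ be integers, let $\gamma_1,\dots,\gamma_M$ be real numbers and let $z_1,\dots,z_n$ be complex numbers. On the space of $k\times k$ complex Hermitian matrices let $D[S]=\prod_{i}dS_{ii}\prod_{i<j}d(\operatorname{Re}S_{ij})\,d(\operatorname{Im}S_{ij})$ be the standard volume element. Let $H$ be a GUE matrix of dimension $N$, that is, a random $N\times N$ Hermitian matrix whose law is the probability measure with density $\mathrm{const}\times e^{-\frac N2\operatorname{Tr}H^2}$ with respect to $D[H]$, and denote by $\langle\cdots\rangle_H$ the average over this law. Put $$\Gamma=\operatorname{diag}(\gamma_1,\dots,\gamma_M,0,\dots,0)\quad(\text{of dimension }N),$$ $$Z_{2n}=\operatorname{diag}(z_1,\dots,z_n,\overline{z}_1,\dots,\overline{z}_n),\qquad L_{2n}=\operatorname{diag}(1,-1)\otimes\mathbf 1_n=\operatorname{diag}(\underbrace{1,\dots,1}_{n},\underbrace{-1,\dots,-1}_{n}).$$ Then both integrals below converge absolutely and $$\Big\langle\prod_{j=1}^n\big|\det(z_j\mathbf 1_N-H-i\Gamma)\big|^2\Big\rangle_{H} =\frac1{2^n}\Big(\frac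 N\pi\Big)^{2n^2}\int D[S_{2n}]\;e^{-\frac N2\operatorname{Tr}S_{2n}^2}\,\det{}^{N-M}(Z_{2n}+iS_{2n})\prod_{j=1}^M\det\big(Z_{2n}+iS_{2n}-i\gamma_jL_{2n}\big),$$ where the integration is over the space of $2n\times 2n$ Hermitian matrices $S_{2n}$. In particular, for $M=1$ and $\gamma_1=\gamma$, $$\Big\langle\prod_{j=1}^n\big|\det(z_j\mathbf 1_N-J_\gamma)\big|^2\Big\rangle =\frac1{2^n}\Big(\frac N\pi\Big)^{2n^2}\int D[S_{2n}]\;e^{-\frac N2\operatorname{Tr}S_{2n}^2}\,\det{}^{N-1}(Z_{2n}+iS_{2n})\det\big(Z_{2n}+iS_{2n}-i\gamma L_{2n}\big),$$ with $J_\gamma=H+i\gamma\operatorname{diag}(1,0,\dots,0)$. -/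

import Mathlib

open MeasureTheory

namespace GUEDuality

noncomputable section

/-- The space of `k × k` complex Hermitian matrices. -/
abbrev HermitianMatrix (k : ℕ) : Type :=
  {A : Matrix (Fin k) (Fin k) ℂ // A.IsHermitian}

/-- The independent entries of a Hermitian matrix: the real diagonal entries and the complex
entries strictly above the diagonal. -/
abbrev HermitianEntries (k : ℕ) : Type :=
  (Fin k → ℝ) × ({p : Fin k × Fin k // p.1 < p.2} → ℂ)

/-- The Hermitian matrix with prescribed independent entries. -/
def hermitianOfEntries {k : ℕ} (x : HermitianEntries k) : HermitianMatrix k :=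
  ⟨Matrix.of fun i j =>
      if h : i < j then x.2 ⟨(i, j), h⟩
      else if h : j < i then star (x.2 ⟨(j, i), h⟩)
      else (x.1 i : ℂ), by
    ext i j
    rcases lt_trichotomy i j with h | h | h
    · simp [Matrix.conjTranspose_apply, h, h.not_gt]
    · subst h
      simp [Matrix.conjTranspose_apply]
    · simp [Matrix.conjTranspose_apply, h, h.not_gt]⟩

/-- The Borel σ-algebra of the entrywise topology. -/
instance instMeasurableSpaceHermitian (k : ℕ) : MeasurableSpace (HermitianMatrix k) := borel _

instance instBorelSpaceHermitian (k : ℕ) : BorelSpace (HermitianMatrix k) := ⟨rfl⟩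

theorem continuous_hermitianOfEntries (k : ℕ) :
    Continuous (hermitianOfEntries : HermitianEntries k → HermitianMatrix k) := by
  refine Continuous.subtype_mk (continuous_matrix fun i j => ?_) _
  simp only [Matrix.of_apply]
  split_ifs <;> fun_prop

/-- The parametrisation is measurable, so the push-forward in `hermitianVolume` is a genuine
one. -/
theorem measurable_hermitianOfEntries (k : ℕ) :
    Measurable (hermitianOfEntries : HermitianEntries k → HermitianMatrix k) :=
  (continuous_hermitianOfEntries k).measurable

/-- The standard volume element
`D[S] = ∏ᵢ dSᵢᵢ ∏_{i<j} d(Re Sᵢⱼ) d(Im Sᵢⱼ)` on Hermitian matrices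
(the volume of `ℂ` is the area measure). -/
def hermitianVolume (k : ℕ) : Measure (HermitianMatrix k) :=
  (volume : Measure (HermitianEntries k)).map hermitianOfEntries

/-- The exponent `-(N/2) Tr S²`, a real number for Hermitian `S`. -/
def gaussianExponent (N : ℕ) {k : ℕ} (S : HermitianMatrix k) : ℝ :=
  -((N : ℝ) / 2) * (Matrix.trace (S.1 ^ 2)).re

/-- The GUE of dimension `N`: the law on Hermitian `N × N` matrices whose density with respect to
the standard volume element is `const * exp (-(N/2) Tr H²)`. -/
def gue (N : ℕ) : Measure (HermitianMatrix N) :=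
  (hermitianVolume N).tilted (gaussianExponent N)

/-- `Γ = diag (γ₁, …, γ_M, 0, …, 0)` of dimension `N`. -/
def deformation (N : ℕ) {M : ℕ} (γ : Fin M → ℝ) : Matrix (Fin N) (Fin N) ℂ :=
  Matrix.diagonal fun i => if h : (i : ℕ) < M then (γ ⟨i, h⟩ : ℂ) else 0

/-- `∏ⱼ |det (zⱼ 1_N - H - i Γ)|²`. -/
def charPolyProduct {N M n : ℕ} (γ : Fin M → ℝ) (z : Fin n → ℂ) (H : HermitianMatrix N) : ℝ :=
  ∏ j, ‖(z j • (1 : Matrix (Fin N) (Fin N) ℂ) - H.1 - Complex.I • deformation N γ).det‖ ^ 2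

/-- `Z = diag (z₁, …, zₙ, z̄₁, …, z̄ₙ)`. -/
def Zmat {n : ℕ} (z : Fin n → ℂ) : Matrix (Fin (n + n)) (Fin (n + n)) ℂ :=
  Matrix.diagonal (Fin.append z (fun j => star (z j)))

/-- `L = diag (1, -1) ⊗ 1ₙ`, that is `n` entries `1` followed by `n` entries `-1`. -/
def Lmat (n : ℕ) : Matrix (Fin (n + n)) (Fin (n + n)) ℂ :=
  Matrix.diagonal (Fin.append (fun _ : Fin n => (1 : ℂ)) (fun _ : Fin n => (-1 : ℂ)))

/-- `exp (-(N/2) Tr S²) det^{N-M} (Z + iS) ∏ⱼ det (Z + iS - i γⱼ L)`; used for `M ≤ N` only. -/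
def dualIntegrand (N : ℕ) {M n : ℕ} (γ : Fin M → ℝ) (z : Fin n → ℂ)
    (S : HermitianMatrix (n + n)) : ℂ :=
  (Real.exp (gaussianExponent N S) : ℂ)
    * (Zmat z + Complex.I • S.1).det ^ (N - M)
    * ∏ j, (Zmat z + Complex.I • S.1 - (Complex.I * (γ j : ℂ)) • Lmat n).det

end

end GUEDuality

/-! Write K = 2n and consider one determinant of size NK, with rows and columns indexed by pairs (i,
a). Let D be the diagonal matrix with entries d i a, where d i a is z_j - iγ_i on the first n values
of a and conj(z_j) + iγ_i on the last n, with γ_i = 0 beyond M. The matrix D - H ⊗ 1 is block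
diagonal over a, and its determinant is the product of squared moduli. The matrix D + i (1 ⊗ S) is
block diagonal over i, and its determinant is the dual product. The claim is thus that the
polynomial det has the same expectation under two Gaussian laws with common mean D.

A Gaussian expectation of a polynomial P depends only on the mean and on the iterates on P of the
second order operator built from the covariance. By `wick_eq_of_secondOrder_eq` it therefore
suffices that the two operators agree on det itself: they commute, so agreement passes to all their
iterates and to derivatives of P.

On det they agree by antisymmetry (`secondOrder_det_eq`). The two covariances pair the same rows and
columns, up to exchanging the two columns. Exchanging columns in a second derivative of det costs a
sign (`pderiv_pderiv_det_swap`), and the factor i in front of S supplies the matching sign.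

The analytic input is that normalised Gaussian integrals obey Wick's rule, which is integration by
parts (`gaussianFunctional_X_mul`). The prefactor is the reciprocal of the Gaussian integral over 2n
× 2n Hermitian matrices (`integral_exp_double`). -/

namespace GUEDuality

/-! ### Abstract Wick calculus on polynomials -/

section Algebra

open MvPolynomial

variable {σ : Type*} [Fintype σ]

/-- The constant coefficient second order operator `∑ C s t ∂ₛ ∂ₜ`. -/
noncomputable def secondOrder (C : σ → σ → ℂ) : MvPolynomial σ ℂ →ₗ[ℂ] MvPolynomial σ ℂ :=
  ∑ s, ∑ t, C s t • ((pderiv s).toLinearMap ∘ₗ (pderiv t).toLinearMap)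

theorem secondOrder_apply (C : σ → σ → ℂ) (P : MvPolynomial σ ℂ) :
    secondOrder C P = ∑ s, ∑ t, C s t • pderiv s (pderiv t P) := by
  simp [secondOrder, LinearMap.sum_apply]

/-- The commutator of two derivations is a derivation, and this one kills every variable. -/
theorem pderiv_comm_apply {σ : Type*} (s t : σ) (P : MvPolynomial σ ℂ) :
    pderiv s (pderiv t P) = pderiv t (pderiv s P) := by
  classical
  have h : ⁅(pderiv s : Derivation ℂ (MvPolynomial σ ℂ) (MvPolynomial σ ℂ)),
      (pderiv t : Derivation ℂ (MvPolynomial σ ℂ) (MvPolynomial σ ℂ))⁆ = 0 := by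
    refine MvPolynomial.derivation_ext fun i => ?_
    rw [Derivation.commutator_apply, pderiv_X, pderiv_X]
    simp only [Pi.single_apply]
    split_ifs <;> simp
  have h2 := congrArg (fun D => D P) h
  simpa [Derivation.commutator_apply, sub_eq_zero] using h2

theorem pderiv_secondOrder (C : σ → σ → ℂ) (u : σ) (P : MvPolynomial σ ℂ) :
    pderiv u (secondOrder C P) = secondOrder C (pderiv u P) := by
  simp only [secondOrder_apply, map_sum, Derivation.map_smul]
  refine Finset.sum_congr rfl fun s _ => Finset.sum_congr rfl fun t _ => ?_
  rw [pderiv_comm_apply u s, pderiv_comm_apply u t]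

theorem secondOrder_comm (C C' : σ → σ → ℂ) (P : MvPolynomial σ ℂ) :
    secondOrder C (secondOrder C' P) = secondOrder C' (secondOrder C P) := by
  rw [secondOrder_apply C, secondOrder_apply C P]
  simp only [map_sum, map_smul, pderiv_secondOrder]

/-- Truncated subtraction is harmless: for d ≤ 1 the second derivatives vanish, and 0 is homogeneous
of every degree. -/
theorem isHomogeneous_secondOrder (C : σ → σ → ℂ) {P : MvPolynomial σ ℂ} {d : ℕ}
    (hP : P.IsHomogeneous d) : (secondOrder C P).IsHomogeneous (d - 1 - 1) := by
  rw [secondOrder_apply]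
  refine IsHomogeneous.sum _ _ _ fun s _ => IsHomogeneous.sum _ _ _ fun t _ => ?_
  exact (homogeneousSubmodule σ ℂ (d - 1 - 1)).smul_mem _ hP.pderiv.pderiv

/-- Euler's identity ∑ Xₛ ∂ₛP = d P turns Wick's rule into a recursion that lowers the degree. -/
theorem wick_euler {E : MvPolynomial σ ℂ →ₗ[ℂ] ℂ} {m : σ → ℂ} {K : σ → σ → ℂ}
    (hE : ∀ s P, E (X s * P) = m s * E P + ∑ t, K s t * E (pderiv t P))
    {d : ℕ} {P : MvPolynomial σ ℂ} (hP : P.IsHomogeneous d) :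
    (d : ℂ) * E P = ∑ s, m s * E (pderiv s P) + E (secondOrder K P) := by
  have h := congrArg E hP.sum_X_mul_pderiv
  rw [map_sum, map_nsmul, nsmul_eq_mul] at h
  rw [← h, secondOrder_apply]
  simp only [hE, Finset.sum_add_distrib]
  rw [map_sum]
  refine congrArg₂ _ rfl (Finset.sum_congr rfl fun s _ => ?_)
  rw [map_sum]
  refine Finset.sum_congr rfl fun t _ => ?_
  rw [pderiv_comm_apply, map_smul, smul_eq_mul]

/-- Functionals obeying Wick's rule with the same mean agree on a homogeneous polynomial on which
their covariance operators coincide. -/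
theorem wick_eq_of_secondOrder_eq {E₁ E₂ : MvPolynomial σ ℂ →ₗ[ℂ] ℂ} {m : σ → ℂ}
    {C₁ C₂ : σ → σ → ℂ} (h1 : E₁ 1 = E₂ 1)
    (hE₁ : ∀ s P, E₁ (X s * P) = m s * E₁ P + ∑ t, C₁ s t * E₁ (pderiv t P))
    (hE₂ : ∀ s P, E₂ (X s * P) = m s * E₂ P + ∑ t, C₂ s t * E₂ (pderiv t P))
    {d : ℕ} {P : MvPolynomial σ ℂ} (hP : P.IsHomogeneous d)
    (hC : secondOrder C₁ P = secondOrder C₂ P) : E₁ P = E₂ P := by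
  induction d using Nat.strong_induction_on generalizing P with
  | _ d ih =>
    rcases Nat.eq_zero_or_pos d with rfl | hd
    · have hPC : P = C (coeff 0 P) := by
        apply totalDegree_eq_zero_iff_eq_C.mp
        exact Nat.le_zero.mp hP.totalDegree_le
      rw [hPC, ← mul_one (C _), ← smul_eq_C_mul, map_smul, map_smul, h1]
    · have hd0 : (d : ℂ) ≠ 0 := Nat.cast_ne_zero.mpr hd.ne'
      apply mul_left_cancel₀ hd0
      rw [wick_euler hE₁ hP, wick_euler hE₂ hP]
      congr 1
      · refine Finset.sum_congr rfl fun s _ => ?_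
        rw [ih (d - 1) (by omega) hP.pderiv (by rw [← pderiv_secondOrder, hC, pderiv_secondOrder])]
      · rw [ih (d - 1 - 1) (by omega) (isHomogeneous_secondOrder C₁ hP) ?_, hC]
        -- Commutation carries the agreement from P to its image under the operator.
        rw [secondOrder_comm C₂, hC]

end Algebra

/-! ### Second derivatives of the generic determinant -/

section Determinant

open MvPolynomial Matrix

variable {ι : Type*} [Fintype ι] [DecidableEq ι]

theorem isHomogeneous_det_mvPolynomialX :
    (mvPolynomialX ι ι ℂ).det.IsHomogeneous (Fintype.card ι) := by
  rw [det_apply]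
  refine IsHomogeneous.sum _ _ _ fun τ _ => ?_
  have h : (∏ i, mvPolynomialX ι ι ℂ (τ i) i).IsHomogeneous (∑ _i : ι, 1) :=
    IsHomogeneous.prod _ _ _ fun i _ => by
      rw [mvPolynomialX_apply]; exact isHomogeneous_X _ _
  rw [Finset.sum_const, smul_eq_mul, mul_one, Finset.card_univ] at h
  rcases Int.units_eq_one_or (Equiv.Perm.sign τ) with hs | hs <;> rw [hs]
  · simpa using h
  · simpa using h.neg

theorem pderiv_prod_perm {ι : Type*} [DecidableEq ι] (τ : Equiv.Perm ι) (A : Finset ι) (r c : ι) :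
    pderiv (r, c) (∏ i ∈ A, (X (τ i, i) : MvPolynomial (ι × ι) ℂ)) =
      if c ∈ A ∧ τ c = r then ∏ i ∈ A.erase c, X (τ i, i) else 0 := by
  induction A using Finset.induction_on with
  | empty => simp
  | insert a A ha ih =>
    rw [Finset.prod_insert ha, Derivation.leibniz, ih, pderiv_X]
    simp only [Pi.single_apply, Prod.mk.injEq, smul_eq_mul]
    by_cases hac : a = c
    · subst hac
      by_cases hr : τ a = r <;> simp [ha, hr, Finset.erase_insert ha]
    · have hca : c ≠ a := fun h => hac h.symm
      by_cases hc : c ∈ A ∧ τ c = r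
      · have hmem : a ∉ A.erase c := fun h => ha (Finset.mem_of_mem_erase h)
        rw [if_pos hc, if_neg (by tauto), if_pos (by simp [hc.1, hc.2]),
          Finset.erase_insert_of_ne hac, Finset.prod_insert hmem]
        simp
      · rw [if_neg hc, if_neg (by tauto), if_neg (by simpa [hca] using hc)]
        simp

theorem pderiv_pderiv_det (r c r' c' : ι) :
    pderiv (r, c) (pderiv (r', c') (mvPolynomialX ι ι ℂ).det) =
      ∑ τ : Equiv.Perm ι, Equiv.Perm.sign τ •
        if c ≠ c' ∧ τ c = r ∧ τ c' = r' then
          ∏ i ∈ (Finset.univ.erase c').erase c, (X (τ i, i) : MvPolynomial (ι × ι) ℂ) else 0 := by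
  have hsmul : ∀ (s : ι × ι) (u : ℤˣ) (P : MvPolynomial (ι × ι) ℂ),
      pderiv s (u • P) = u • pderiv s P := by
    intro s u P
    rcases Int.units_eq_one_or u with hs | hs <;> simp [hs]
  rw [det_apply, map_sum, map_sum]
  refine Finset.sum_congr rfl fun τ _ => ?_
  rw [hsmul, hsmul]
  congr 1
  simp only [mvPolynomialX_apply]
  rw [pderiv_prod_perm]
  by_cases h' : τ c' = r'
  · rw [if_pos ⟨Finset.mem_univ _, h'⟩, pderiv_prod_perm]
    simp [h']
  · simp [h']

/-- Second derivatives of the determinant are alternating in the columns. -/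
theorem pderiv_pderiv_det_swap (r c r' c' : ι) :
    pderiv (r, c) (pderiv (r', c') (mvPolynomialX ι ι ℂ).det) =
      -pderiv (r, c') (pderiv (r', c) (mvPolynomialX ι ι ℂ).det) := by
  rw [pderiv_pderiv_det, pderiv_pderiv_det, ← Finset.sum_neg_distrib]
  by_cases hcc : c = c'
  · subst hcc; simp
  -- Precomposing τ with the transposition of the two columns flips its sign and leaves the monomial
  -- in the remaining columns unchanged.
  refine Fintype.sum_equiv (Equiv.mulRight (Equiv.swap c c')) _ _ fun τ => ?_
  have hs : Equiv.Perm.sign (τ * Equiv.swap c c') = -Equiv.Perm.sign τ := by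
    rw [Equiv.Perm.sign_mul, Equiv.Perm.sign_swap hcc]; simp
  simp only [Equiv.coe_mulRight, hs, Equiv.Perm.mul_apply, Equiv.swap_apply_left,
    Equiv.swap_apply_right, Units.neg_smul, neg_neg]
  congr 1
  refine if_congr (by simp [hcc, Ne.symm hcc]) ?_ rfl
  rw [Finset.erase_right_comm]
  refine Finset.prod_congr rfl fun i hi => ?_
  simp only [Finset.mem_erase, Finset.mem_univ, and_true] at hi
  rw [Equiv.swap_apply_of_ne_of_ne hi.2 hi.1]

end Determinant

/-! ### Gaussian weight in the independent entries -/

section Gaussian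

open MvPolynomial Matrix

variable {k : ℕ}

/-- Squared Hilbert–Schmidt norm in terms of the independent entries. -/
noncomputable def entriesNormSq (x : HermitianEntries k) : ℝ :=
  ∑ i, x.1 i ^ 2 + 2 * ∑ p, ‖x.2 p‖ ^ 2

theorem hermitianOfEntries_apply_of_lt (x : HermitianEntries k) {i j : Fin k} (h : i < j) :
    (hermitianOfEntries x).1 i j = x.2 ⟨(i, j), h⟩ := by
  simp [hermitianOfEntries, h]

theorem hermitianOfEntries_apply_of_gt (x : HermitianEntries k) {i j : Fin k} (h : j < i) :
    (hermitianOfEntries x).1 i j = star (x.2 ⟨(j, i), h⟩) := by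
  simp [hermitianOfEntries, h, h.not_gt]

theorem hermitianOfEntries_apply_self (x : HermitianEntries k) (i : Fin k) :
    (hermitianOfEntries x).1 i i = x.1 i := by
  simp [hermitianOfEntries]

theorem hermitianOfEntries_apply_swap (x : HermitianEntries k) (i j : Fin k) :
    (hermitianOfEntries x).1 j i = star ((hermitianOfEntries x).1 i j) :=
  ((hermitianOfEntries x).2.apply j i).symm

theorem hermitianOfEntries_add_smul (x v : HermitianEntries k) (t : ℝ) (i j : Fin k) :
    (hermitianOfEntries (x + t • v)).1 i j =
      (hermitianOfEntries x).1 i j + t * (hermitianOfEntries v).1 i j := by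
  rcases lt_trichotomy i j with h | h | h
  · simp [hermitianOfEntries_apply_of_lt _ h]
  · subst h; simp [hermitianOfEntries_apply_self]
  · simp [hermitianOfEntries_apply_of_gt _ h]

theorem exists_hermitianOfEntries_eq {A : Matrix (Fin k) (Fin k) ℂ} (hA : A.IsHermitian) :
    ∃ x : HermitianEntries k, (hermitianOfEntries x).1 = A := by
  refine ⟨(fun i => (A i i).re, fun p => A p.1.1 p.1.2), ?_⟩
  ext i j
  rcases lt_trichotomy i j with h | h | h
  · simp [hermitianOfEntries_apply_of_lt _ h]
  · subst h
    rw [hermitianOfEntries_apply_self]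
    exact Complex.conj_eq_iff_re.mp (hA.apply i i)
  · rw [hermitianOfEntries_apply_of_gt _ h]
    exact hA.apply i j

theorem continuous_entry (i j : Fin k) :
    Continuous fun x : HermitianEntries k => (hermitianOfEntries x).1 i j :=
  (continuous_subtype_val.comp (continuous_hermitianOfEntries k)).matrix_elem i j

theorem sum_sum_eq_diag_add_lt (f : Fin k → Fin k → ℝ) (hf : ∀ i j, f i j = f j i) :
    ∑ i, ∑ j, f i j =
      ∑ i, f i i + 2 * ∑ p : {p : Fin k × Fin k // p.1 < p.2}, f p.1.1 p.1.2 := by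
  have hlt : ∑ p : {p : Fin k × Fin k // p.1 < p.2}, f p.1.1 p.1.2 =
      ∑ i, ∑ j, if i < j then f i j else 0 := by
    rw [← Finset.sum_product', Finset.univ_product_univ, ← Finset.sum_filter]
    exact (Finset.sum_subtype _ (by simp) fun p : Fin k × Fin k => f p.1 p.2).symm
  have hgt : ∑ p : {p : Fin k × Fin k // p.1 < p.2}, f p.1.1 p.1.2 =
      ∑ i, ∑ j, if j < i then f i j else 0 := by
    rw [hlt, Finset.sum_comm]
    simp only [hf]
  have hdiag : ∑ i, f i i = ∑ i, ∑ j, if i = j then f i j else 0 := by simp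
  rw [two_mul, hdiag]
  nth_rewrite 1 [hlt]
  rw [hgt]
  simp only [← Finset.sum_add_distrib]
  refine Finset.sum_congr rfl fun i _ => Finset.sum_congr rfl fun j _ => ?_
  rcases lt_trichotomy i j with h | h | h
  · simp [h, h.ne, h.not_gt]
  · simp [h]
  · simp [h, h.ne', h.not_gt]

/-- Counts off-diagonal entries for the normalising constant, by splitting the double sum of the
constant 1. -/
theorem two_mul_card_lt (k : ℕ) :
    k + 2 * Fintype.card {p : Fin k × Fin k // p.1 < p.2} = k * k := by
  have h := sum_sum_eq_diag_add_lt (k := k) (fun _ _ => 1) fun _ _ => rfl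
  simp only [Finset.sum_const, Finset.card_univ, Fintype.card_fin, nsmul_eq_mul, mul_one] at h
  exact_mod_cast h.symm

theorem entriesNormSq_eq_sum (x : HermitianEntries k) :
    entriesNormSq x = ∑ i, ∑ j, ‖(hermitianOfEntries x).1 i j‖ ^ 2 := by
  rw [sum_sum_eq_diag_add_lt _ fun i j => by rw [hermitianOfEntries_apply_swap x i j, norm_star]]
  simp only [hermitianOfEntries_apply_self, entriesNormSq, Complex.norm_real, Real.norm_eq_abs,
    sq_abs]
  congr 2
  refine Finset.sum_congr rfl fun p _ => ?_
  rw [hermitianOfEntries_apply_of_lt x p.2]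

theorem ofReal_entriesNormSq (x : HermitianEntries k) :
    (entriesNormSq x : ℂ) =
      ∑ i, ∑ j, (hermitianOfEntries x).1 i j * (hermitianOfEntries x).1 j i := by
  rw [entriesNormSq_eq_sum]
  push_cast
  refine Finset.sum_congr rfl fun i _ => Finset.sum_congr rfl fun j _ => ?_
  rw [hermitianOfEntries_apply_swap x i j]
  exact (Complex.mul_conj' _).symm

theorem gaussianExponent_hermitianOfEntries (N : ℕ) (x : HermitianEntries k) :
    gaussianExponent N (hermitianOfEntries x) = -((N : ℝ) / 2) * entriesNormSq x := by
  have h : trace ((hermitianOfEntries x).1 ^ 2) = (entriesNormSq x : ℂ) := by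
    rw [ofReal_entriesNormSq, pow_two]
    simp [trace, mul_apply]
  rw [gaussianExponent, h, Complex.ofReal_re]

theorem norm_sq_entry_le (x : HermitianEntries k) (i j : Fin k) :
    ‖(hermitianOfEntries x).1 i j‖ ^ 2 ≤ entriesNormSq x := by
  rw [entriesNormSq_eq_sum]
  refine le_trans ?_ (Finset.single_le_sum (f := fun i => ∑ j, ‖(hermitianOfEntries x).1 i j‖ ^ 2)
    (fun i _ => Finset.sum_nonneg fun j _ => by positivity) (Finset.mem_univ i))
  exact Finset.single_le_sum (f := fun j => ‖(hermitianOfEntries x).1 i j‖ ^ 2)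
    (fun j _ => by positivity) (Finset.mem_univ j)

theorem entriesNormSq_nonneg (x : HermitianEntries k) : 0 ≤ entriesNormSq x := by
  unfold entriesNormSq; positivity

theorem continuous_entriesNormSq : Continuous (entriesNormSq (k := k)) := by
  unfold entriesNormSq; fun_prop

theorem exp_neg_mul_entriesNormSq (b : ℝ) (x : HermitianEntries k) :
    Real.exp (-b * entriesNormSq x) =
      (∏ i, Real.exp (-b * x.1 i ^ 2)) * ∏ p, Real.exp (-(2 * b) * ‖x.2 p‖ ^ 2) := by
  rw [← Real.exp_sum, ← Real.exp_sum, ← Real.exp_add, entriesNormSq, ← Finset.mul_sum,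
    ← Finset.mul_sum]
  ring_nf

theorem integrable_exp_neg_mul_norm_sq {b : ℝ} (hb : 0 < b) :
    Integrable fun c : ℂ => Real.exp (-b * ‖c‖ ^ 2) := by
  have h := (GaussianFourier.integrable_cexp_neg_mul_sq_norm_add (V := ℂ) (b := (b : ℂ))
    (by simpa using hb) 0 0).norm
  refine h.congr (Filter.Eventually.of_forall fun c => ?_)
  simp only [Complex.norm_exp]
  norm_cast
  simp

theorem integrable_exp_neg_mul_entriesNormSq {b : ℝ} (hb : 0 < b) :
    Integrable fun x : HermitianEntries k => Real.exp (-b * entriesNormSq x) := by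
  simp only [exp_neg_mul_entriesNormSq]
  refine Integrable.mul_prod (f := fun y : Fin k → ℝ => ∏ i, Real.exp (-b * y i ^ 2))
    (g := fun y : {p : Fin k × Fin k // p.1 < p.2} → ℂ =>
      ∏ p, Real.exp (-(2 * b) * ‖y p‖ ^ 2)) ?_ ?_
  · exact Integrable.fintype_prod (f := fun (_ : Fin k) (t : ℝ) => Real.exp (-b * t ^ 2))
      fun _ => integrable_exp_neg_mul_sq hb
  · exact Integrable.fintype_prod
      (f := fun (_ : {p : Fin k × Fin k // p.1 < p.2}) (c : ℂ) => Real.exp (-(2 * b) * ‖c‖ ^ 2))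
      fun _ => integrable_exp_neg_mul_norm_sq (by positivity)

theorem integral_exp_neg_mul_entriesNormSq {b : ℝ} (hb : 0 < b) :
    ∫ x : HermitianEntries k, Real.exp (-b * entriesNormSq x) =
      √(Real.pi / b) ^ k * (Real.pi / (2 * b)) ^ Fintype.card {p : Fin k × Fin k // p.1 < p.2} := by
  simp only [exp_neg_mul_entriesNormSq]
  rw [Measure.volume_eq_prod, 
    integral_prod_mul (f := fun y : Fin k → ℝ => ∏ i, Real.exp (-b * y i ^ 2))
    (g := fun y : {p : Fin k × Fin k // p.1 < p.2} → ℂ =>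
      ∏ p, Real.exp (-(2 * b) * ‖y p‖ ^ 2)),
    integral_fintype_prod_volume_eq_pow (fun t : ℝ => Real.exp (-b * t ^ 2)),
    integral_fintype_prod_volume_eq_pow (fun c : ℂ => Real.exp (-(2 * b) * ‖c‖ ^ 2)),
    integral_gaussian, GaussianFourier.integral_rexp_neg_mul_sq_norm (by positivity)]
  simp

end Gaussian

/-! ### Integrability, integration by parts and Wick's rule -/

section Wick

open MvPolynomial Matrix

variable {k : ℕ} {σ : Type*}

theorem hasDerivAt_eval [Fintype σ] {u : ℝ → σ → ℂ} {u' : σ → ℂ} {t : ℝ}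
    (hu : ∀ s, HasDerivAt (fun t => u t s) (u' s) t) (P : MvPolynomial σ ℂ) :
    HasDerivAt (fun t => eval (u t) P) (∑ s, eval (u t) (pderiv s P) * u' s) t := by
  classical
  induction P using MvPolynomial.induction_on with
  | C c => simpa using hasDerivAt_const t c
  | add P Q hP hQ =>
    simp only [map_add, add_mul, Finset.sum_add_distrib]
    exact hP.add hQ
  | mul_X P s hP =>
    simp only [map_mul, eval_X]
    refine (hP.mul (hu s)).congr_deriv ?_
    simp only [Derivation.leibniz, smul_eq_mul, map_add, map_mul, eval_X, pderiv_X, add_mul,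
      Finset.sum_add_distrib, Finset.sum_mul]
    rw [add_comm]
    refine congrArg₂ _ ?_ (Finset.sum_congr rfl fun i _ => by ring)
    rw [Finset.sum_eq_single s]
    · simp
    · intro b _ hb
      simp [hb.symm]
    · simp

/-- The point with coordinates `m s + ∑ a s i j S i j`, where `S` is the Hermitian matrix with
entries `x`. -/
noncomputable def affineForm (m : σ → ℂ) (a : σ → Fin k → Fin k → ℂ) (x : HermitianEntries k)
    (s : σ) : ℂ :=
  m s + ∑ i, ∑ j, a s i j * (hermitianOfEntries x).1 i j

theorem continuous_affineForm (m : σ → ℂ) (a : σ → Fin k → Fin k → ℂ) :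
    Continuous (affineForm m a) := by
  refine continuous_pi fun s => continuous_const.add ?_
  exact continuous_finsetSum _ fun i _ => continuous_finsetSum _ fun j _ =>
    continuous_const.mul (continuous_entry i j)

theorem continuous_eval_affineForm (m : σ → ℂ) (a : σ → Fin k → Fin k → ℂ)
    (P : MvPolynomial σ ℂ) : Continuous fun x => eval (affineForm m a x) P :=
  (MvPolynomial.continuous_eval P).comp (continuous_affineForm m a)

/-- `F` is dominated by every Gaussian of positive exponent. -/
def SubGaussianGrowth (F : HermitianEntries k → ℂ) : Prop :=
  ∀ b : ℝ, 0 < b → ∃ K : ℝ, ∀ x, ‖F x‖ ≤ K * Real.exp (b * entriesNormSq x)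

theorem SubGaussianGrowth.const (c : ℂ) : SubGaussianGrowth (k := k) fun _ => c := by
  intro b hb
  refine ⟨‖c‖, fun x => le_mul_of_one_le_right (norm_nonneg c) ?_⟩
  exact Real.one_le_exp (mul_nonneg hb.le (entriesNormSq_nonneg x))

theorem SubGaussianGrowth.add {F G : HermitianEntries k → ℂ} (hF : SubGaussianGrowth F)
    (hG : SubGaussianGrowth G) : SubGaussianGrowth fun x => F x + G x := by
  intro b hb
  obtain ⟨K, hK⟩ := hF b hb
  obtain ⟨K', hK'⟩ := hG b hb
  refine ⟨K + K', fun x => (norm_add_le _ _).trans ?_⟩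
  rw [add_mul]
  exact add_le_add (hK x) (hK' x)

theorem SubGaussianGrowth.mul {F G : HermitianEntries k → ℂ} (hF : SubGaussianGrowth F)
    (hG : SubGaussianGrowth G) : SubGaussianGrowth fun x => F x * G x := by
  intro b hb
  obtain ⟨K, hK⟩ := hF (b / 2) (by positivity)
  obtain ⟨K', hK'⟩ := hG (b / 2) (by positivity)
  refine ⟨K * K', fun x => ?_⟩
  rw [norm_mul]
  refine (mul_le_mul (hK x) (hK' x) (norm_nonneg _) ((norm_nonneg _).trans (hK x))).trans_eq ?_
  rw [mul_mul_mul_comm, ← Real.exp_add]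
  ring_nf

theorem SubGaussianGrowth.sum {α : Type*} (A : Finset α) {F : α → HermitianEntries k → ℂ}
    (hF : ∀ i ∈ A, SubGaussianGrowth (F i)) : SubGaussianGrowth fun x => ∑ i ∈ A, F i x := by
  classical
  induction A using Finset.induction_on with
  | empty => simpa using SubGaussianGrowth.const 0
  | insert i A hi ih =>
    simp only [Finset.sum_insert hi]
    exact (hF i (by simp)).add (ih fun j hj => hF j (by simp [hj]))

theorem subGaussianGrowth_entry (i j : Fin k) :
    SubGaussianGrowth fun x : HermitianEntries k => (hermitianOfEntries x).1 i j := by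
  intro b hb
  refine ⟨1 + 1 / b, fun x => ?_⟩
  have h1 := norm_sq_entry_le x i j
  have h2 := Real.add_one_le_exp (b * entriesNormSq x)
  have h0 := entriesNormSq_nonneg x
  have h3 : 1 ≤ Real.exp (b * entriesNormSq x) := Real.one_le_exp (by positivity)
  have h4 : entriesNormSq x ≤ 1 / b * Real.exp (b * entriesNormSq x) := by
    rw [one_div, inv_mul_eq_div, le_div_iff₀ hb]; linarith
  -- Uses t ≤ (1 + t²)/2 and t² ≤ exp(b q)/b, where t is the norm of the entry and q =
  -- `entriesNormSq x`.
  nlinarith [sq_nonneg (‖(hermitianOfEntries x).1 i j‖ - 1)]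

theorem subGaussianGrowth_eval (m : σ → ℂ) (a : σ → Fin k → Fin k → ℂ) (P : MvPolynomial σ ℂ) :
    SubGaussianGrowth fun x => eval (affineForm m a x) P := by
  induction P using MvPolynomial.induction_on with
  | C c => simpa using SubGaussianGrowth.const c
  | add P Q hP hQ => simpa using hP.add hQ
  | mul_X P s hP =>
    simp only [map_mul, eval_X]
    refine hP.mul ((SubGaussianGrowth.const (m s)).add ?_)
    exact SubGaussianGrowth.sum _ fun i _ => SubGaussianGrowth.sum _ fun j _ =>
      (SubGaussianGrowth.const _).mul (subGaussianGrowth_entry i j)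

theorem SubGaussianGrowth.integrable_mul_exp {F : HermitianEntries k → ℂ}
    (hF : SubGaussianGrowth F) (hc : Continuous F) {b : ℝ} (hb : 0 < b) :
    Integrable fun x => F x * (Real.exp (-b * entriesNormSq x) : ℂ) := by
  obtain ⟨K, hK⟩ := hF (b / 2) (by positivity)
  refine ((integrable_exp_neg_mul_entriesNormSq (k := k) (half_pos hb)).const_mul K).mono'
    (Continuous.aestronglyMeasurable ?_) (Filter.Eventually.of_forall fun x => ?_)
  · exact hc.mul (Complex.continuous_ofReal.comp
      (Real.continuous_exp.comp (continuous_const.mul continuous_entriesNormSq)))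
  · rw [norm_mul, Complex.norm_real, Real.norm_eq_abs, Real.abs_exp]
    refine (mul_le_mul_of_nonneg_right (hK x) (Real.exp_pos _).le).trans_eq ?_
    rw [mul_assoc, ← Real.exp_add]
    ring_nf

/-- The unnormalised Gaussian expectation of a polynomial in the affine forms `affineForm m a`. -/
noncomputable def gaussianFunctional {b : ℝ} (hb : 0 < b) (m : σ → ℂ)
    (a : σ → Fin k → Fin k → ℂ) : MvPolynomial σ ℂ →ₗ[ℂ] ℂ where
  toFun P := ∫ x, eval (affineForm m a x) P * (Real.exp (-b * entriesNormSq x) : ℂ)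
  map_add' P Q := by
    simp only [map_add, add_mul]
    exact integral_add
      ((subGaussianGrowth_eval m a P).integrable_mul_exp (continuous_eval_affineForm m a P) hb)
      ((subGaussianGrowth_eval m a Q).integrable_mul_exp (continuous_eval_affineForm m a Q) hb)
  map_smul' c P := by
    simp only [smul_eval, mul_assoc, integral_const_mul, RingHom.id_apply, smul_eq_mul]

theorem gaussianFunctional_apply {b : ℝ} (hb : 0 < b) (m : σ → ℂ) (a : σ → Fin k → Fin k → ℂ)
    (P : MvPolynomial σ ℂ) : gaussianFunctional hb m a P =
      ∫ x, eval (affineForm m a x) P * (Real.exp (-b * entriesNormSq x) : ℂ) := rfl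

theorem hasLineDerivAt_exp (b : ℝ) (x v : HermitianEntries k) :
    HasLineDerivAt ℝ (fun x => (Real.exp (-b * entriesNormSq x) : ℂ))
      (-(2 * b) * (∑ i, ∑ j, (hermitianOfEntries v).1 j i * (hermitianOfEntries x).1 i j) *
        (Real.exp (-b * entriesNormSq x) : ℂ)) x v := by
  have hentry : ∀ i j, HasDerivAt (fun t : ℝ => (hermitianOfEntries (x + t • v)).1 i j)
      ((hermitianOfEntries v).1 i j) 0 := by
    intro i j
    simp only [hermitianOfEntries_add_smul]
    simpa using ((Complex.ofRealCLM.hasDerivAt (x := (0 : ℝ))).mul_const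
      ((hermitianOfEntries v).1 i j)).const_add ((hermitianOfEntries x).1 i j)
  have hq : HasDerivAt (fun t : ℝ => (entriesNormSq (x + t • v) : ℂ))
      (2 * ∑ i, ∑ j, (hermitianOfEntries v).1 j i * (hermitianOfEntries x).1 i j) 0 := by
    simp only [ofReal_entriesNormSq]
    refine (HasDerivAt.fun_sum fun i _ => HasDerivAt.fun_sum fun j _ =>
      (hentry i j).mul (hentry j i)).congr_deriv ?_
    simp only [zero_smul, add_zero, Finset.sum_add_distrib, two_mul]
    refine congrArg₂ _ ?_ (Finset.sum_congr rfl fun i _ => Finset.sum_congr rfl fun j _ =>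
      mul_comm _ _)
    rw [Finset.sum_comm]
  unfold HasLineDerivAt
  have h := ((hq.const_mul (-(b : ℂ))).cexp)
  simp only [zero_smul, add_zero] at h
  simp only [Complex.ofReal_exp, Complex.ofReal_mul, Complex.ofReal_neg]
  exact h.congr_deriv (by ring)

theorem hasLineDerivAt_eval_affineForm [Fintype σ] (m : σ → ℂ) (a : σ → Fin k → Fin k → ℂ)
    (P : MvPolynomial σ ℂ) (x v : HermitianEntries k) :
    HasLineDerivAt ℝ (fun x => eval (affineForm m a x) P)
      (∑ s, eval (affineForm m a x) (pderiv s P) *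
        ∑ i, ∑ j, a s i j * (hermitianOfEntries v).1 i j) x v := by
  unfold HasLineDerivAt
  have hu : ∀ s, HasDerivAt (fun t : ℝ => affineForm m a (x + t • v) s)
      (∑ i, ∑ j, a s i j * (hermitianOfEntries v).1 i j) 0 := by
    intro s
    refine HasDerivAt.const_add _ (HasDerivAt.fun_sum fun i _ => HasDerivAt.fun_sum fun j _ =>
      HasDerivAt.const_mul _ ?_)
    simp only [hermitianOfEntries_add_smul]
    simpa using ((Complex.ofRealCLM.hasDerivAt (x := (0 : ℝ))).mul_const
      ((hermitianOfEntries v).1 i j)).const_add ((hermitianOfEntries x).1 i j)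
  simpa using hasDerivAt_eval hu P

/-- A linear functional on matrices that vanishes on Hermitian matrices vanishes. -/
theorem eq_zero_of_forall_isHermitian (ℓ : Matrix (Fin k) (Fin k) ℂ →ₗ[ℂ] ℂ)
    (h : ∀ A : Matrix (Fin k) (Fin k) ℂ, A.IsHermitian → ℓ A = 0) : ℓ = 0 := by
  ext A
  rw [← realPart_add_I_smul_imaginaryPart A, map_add, map_smul, h _ (realPart A).2,
    h _ (imaginaryPart A).2]
  simp

theorem integrable_entry_mul_eval {b : ℝ} (hb : 0 < b) (m : σ → ℂ) (a : σ → Fin k → Fin k → ℂ)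
    (P : MvPolynomial σ ℂ) (i j : Fin k) : Integrable fun x : HermitianEntries k =>
      (hermitianOfEntries x).1 i j *
        (eval (affineForm m a x) P * (Real.exp (-b * entriesNormSq x) : ℂ)) := by
  simp only [← mul_assoc]
  exact ((subGaussianGrowth_entry i j).mul (subGaussianGrowth_eval m a P)).integrable_mul_exp
    ((continuous_entry i j).mul (continuous_eval_affineForm m a P)) hb

theorem integrable_eval {b : ℝ} (hb : 0 < b) (m : σ → ℂ) (a : σ → Fin k → Fin k → ℂ)
    (P : MvPolynomial σ ℂ) : Integrable fun x : HermitianEntries k =>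
        (eval (affineForm m a x) P * (Real.exp (-b * entriesNormSq x) : ℂ)) :=
  (subGaussianGrowth_eval m a P).integrable_mul_exp (continuous_eval_affineForm m a P) hb

/-- Gaussian integration by parts in a Hermitian direction. -/
theorem integration_by_parts_hermitian [Fintype σ] {b : ℝ} (hb : 0 < b) (m : σ → ℂ)
    (a : σ → Fin k → Fin k → ℂ) (P : MvPolynomial σ ℂ) {V : Matrix (Fin k) (Fin k) ℂ}
    (hV : V.IsHermitian) :
    2 * b * ∑ i, ∑ j, V j i * ∫ x : HermitianEntries k, (hermitianOfEntries x).1 i j *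
        (eval (affineForm m a x) P * (Real.exp (-b * entriesNormSq x) : ℂ)) =
      ∑ s, (∑ i, ∑ j, a s i j * V i j) * gaussianFunctional hb m a (pderiv s P) := by
  obtain ⟨v, rfl⟩ := exists_hermitianOfEntries_eq hV
  set V := (hermitianOfEntries v).1
  have hE : ∀ x : HermitianEntries k,
      eval (affineForm m a x) P * (-(2 * b) * (∑ i, ∑ j, V j i * (hermitianOfEntries x).1 i j) *
        (Real.exp (-b * entriesNormSq x) : ℂ)) =
      ∑ i, ∑ j, -(2 * b) * V j i * ((hermitianOfEntries x).1 i j *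
        (eval (affineForm m a x) P * (Real.exp (-b * entriesNormSq x) : ℂ))) := by
    intro x
    simp only [Finset.mul_sum, Finset.sum_mul]
    exact Finset.sum_congr rfl fun i _ => Finset.sum_congr rfl fun j _ => by ring
  have hP : ∀ x : HermitianEntries k,
      (∑ s, eval (affineForm m a x) (pderiv s P) * ∑ i, ∑ j, a s i j * V i j) *
        (Real.exp (-b * entriesNormSq x) : ℂ) =
      ∑ s, (∑ i, ∑ j, a s i j * V i j) * (eval (affineForm m a x) (pderiv s P) *
        (Real.exp (-b * entriesNormSq x) : ℂ)) := by
    intro x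
    rw [Finset.sum_mul]
    exact Finset.sum_congr rfl fun s _ => by ring
  have iE : ∀ i j, Integrable fun x : HermitianEntries k =>
      -(2 * b) * V j i * ((hermitianOfEntries x).1 i j *
        (eval (affineForm m a x) P * (Real.exp (-b * entriesNormSq x) : ℂ))) :=
    fun i j => (integrable_entry_mul_eval hb m a P i j).const_mul _
  have iP : ∀ s, Integrable fun x : HermitianEntries k =>
      (∑ i, ∑ j, a s i j * V i j) * (eval (affineForm m a x) (pderiv s P) *
        (Real.exp (-b * entriesNormSq x) : ℂ)) :=
    fun s => (integrable_eval hb m a (pderiv s P)).const_mul _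
  have : (volume : Measure (HermitianEntries k)).IsAddHaarMeasure := by
    rw [Measure.volume_eq_prod]; exact Measure.prod.instIsAddHaarMeasure _ _
  have h := integral_bilinear_hasLineDerivAt_right_eq_neg_left_of_integrable
    (μ := (volume : Measure (HermitianEntries k))) (B := ContinuousLinearMap.mul ℝ ℂ) (v := v)
    (f := fun x => eval (affineForm m a x) P)
    (g := fun x => (Real.exp (-b * entriesNormSq x) : ℂ))
    (by
      simp only [ContinuousLinearMap.mul_apply']
      exact (integrable_finsetSum _ fun s _ => iP s).congr
        (Filter.Eventually.of_forall fun x => (hP x).symm))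
    (by
      simp only [ContinuousLinearMap.mul_apply']
      exact (integrable_finsetSum _ fun i _ => integrable_finsetSum _ fun j _ => iE i j).congr
        (Filter.Eventually.of_forall fun x => (hE x).symm))
    (by simpa only [ContinuousLinearMap.mul_apply'] using integrable_eval hb m a P)
    (fun x _ => hasLineDerivAt_eval_affineForm m a P x v)
    (fun x _ => hasLineDerivAt_exp b x v)
  simp only [ContinuousLinearMap.mul_apply'] at h
  rw [integral_congr_ae (Filter.Eventually.of_forall hE),
    integral_congr_ae (Filter.Eventually.of_forall hP),
    integral_finsetSum _ fun s _ => iP s,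
    integral_finsetSum _ fun i _ => integrable_finsetSum _ fun j _ => iE i j] at h
  simp only [integral_finsetSum _ fun j _ => iE _ j, integral_const_mul] at h
  rw [← neg_inj]
  simp only [gaussianFunctional_apply]
  rw [← h]
  simp only [Finset.mul_sum, ← Finset.sum_neg_distrib]
  exact Finset.sum_congr rfl fun i _ => Finset.sum_congr rfl fun j _ => by ring

/-- Integration by parts is available only along Hermitian V, but both sides are complex linear in
V, so it extends to all V; the matrix unit at (q, p) isolates one entry. -/
theorem integral_entry_mul_eval [Fintype σ] {b : ℝ} (hb : 0 < b) (m : σ → ℂ)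
    (a : σ → Fin k → Fin k → ℂ) (P : MvPolynomial σ ℂ) (p q : Fin k) :
    2 * b * ∫ x : HermitianEntries k, (hermitianOfEntries x).1 p q *
        (eval (affineForm m a x) P * (Real.exp (-b * entriesNormSq x) : ℂ)) =
      ∑ s, a s q p * gaussianFunctional hb m a (pderiv s P) := by
  let J : Fin k → Fin k → ℂ := fun i j => ∫ x : HermitianEntries k,
    (hermitianOfEntries x).1 i j *
        (eval (affineForm m a x) P * (Real.exp (-b * entriesNormSq x) : ℂ))
  let ent : Fin k → Fin k → Matrix (Fin k) (Fin k) ℂ →ₗ[ℂ] ℂ := fun i j =>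
    entryLinearMap ℂ ℂ i j
  let ℓ : Matrix (Fin k) (Fin k) ℂ →ₗ[ℂ] ℂ :=
    (2 * b : ℂ) • (∑ i, ∑ j, J i j • ent j i) -
      ∑ s, gaussianFunctional hb m a (pderiv s P) • ∑ i, ∑ j, a s i j • ent i j
  have hℓ : ∀ V, ℓ V = 2 * b * ∑ i, ∑ j, V j i * J i j -
      ∑ s, (∑ i, ∑ j, a s i j * V i j) * gaussianFunctional hb m a (pderiv s P) := by
    intro V
    simp only [ℓ, ent, LinearMap.sub_apply, LinearMap.smul_apply, LinearMap.sum_apply,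
      entryLinearMap_apply, smul_eq_mul, mul_comm]
  have h0 := eq_zero_of_forall_isHermitian ℓ fun V hV => by
    rw [hℓ, sub_eq_zero]; exact integration_by_parts_hermitian hb m a P hV
  have h1 := hℓ (Matrix.single q p 1)
  rw [h0, LinearMap.zero_apply, eq_comm, sub_eq_zero] at h1
  simpa [Matrix.single_apply, ite_and, J] using h1

/-- Wick's rule. The index reversal in a t j i reflects that, after normalisation, the only nonzero
covariance of S i j is with S j i, equal to 1/(2b). -/
theorem gaussianFunctional_X_mul [Fintype σ] {b : ℝ} (hb : 0 < b) (m : σ → ℂ)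
    (a : σ → Fin k → Fin k → ℂ) (s : σ) (P : MvPolynomial σ ℂ) :
    gaussianFunctional hb m a (X s * P) = m s * gaussianFunctional hb m a P +
      ∑ t, ((2 * b : ℂ)⁻¹ * ∑ i, ∑ j, a s i j * a t j i) *
        gaussianFunctional hb m a (pderiv t P) := by
  have hb' : (2 * b : ℂ) ≠ 0 := by exact_mod_cast (by positivity : (2 * b) ≠ 0)
  have h1 : gaussianFunctional hb m a (X s * P) = m s * gaussianFunctional hb m a P +
      ∑ i, ∑ j, a s i j * ∫ x : HermitianEntries k, (hermitianOfEntries x).1 i j *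
        (eval (affineForm m a x) P * (Real.exp (-b * entriesNormSq x) : ℂ)) := by
    have iE : ∀ i j, Integrable fun x : HermitianEntries k =>
        a s i j * ((hermitianOfEntries x).1 i j *
          (eval (affineForm m a x) P * (Real.exp (-b * entriesNormSq x) : ℂ))) :=
      fun i j => (integrable_entry_mul_eval hb m a P i j).const_mul _
    simp only [← integral_const_mul]
    simp only [← integral_finsetSum _ fun j _ => iE _ j]
    rw [← integral_finsetSum _ fun i _ => integrable_finsetSum _ fun j _ => iE i j]
    simp only [gaussianFunctional_apply, ← integral_const_mul]
    rw [← integral_add ((integrable_eval hb m a P).const_mul _)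
      (integrable_finsetSum _ fun i _ => integrable_finsetSum _ fun j _ => iE i j)]
    refine integral_congr_ae (Filter.Eventually.of_forall fun x => ?_)
    simp only [map_mul, eval_X]
    nth_rewrite 1 [affineForm]
    simp only [add_mul, Finset.sum_mul, mul_assoc]
  rw [h1]
  congr 1
  have h2 : ∀ i j, ∫ x : HermitianEntries k, (hermitianOfEntries x).1 i j *
        (eval (affineForm m a x) P * (Real.exp (-b * entriesNormSq x) : ℂ)) =
      (2 * b : ℂ)⁻¹ * ∑ t, a t j i * gaussianFunctional hb m a (pderiv t P) := by
    intro i j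
    rw [← integral_entry_mul_eval, inv_mul_cancel_left₀ hb']
  simp only [h2, Finset.mul_sum, Finset.sum_mul]
  rw [Finset.sum_comm' (t' := Finset.univ) (s' := fun _ => Finset.univ) (by simp)]
  rw [Finset.sum_comm]
  rw [Finset.sum_congr rfl fun i _ => Finset.sum_comm, Finset.sum_comm]
  refine Finset.sum_congr rfl fun t _ => Finset.sum_congr rfl fun i _ =>
    Finset.sum_congr rfl fun j _ => by ring

end Wick

/-! ### The two tensor embeddings and their duality -/

section Duality

open MvPolynomial Matrix

variable {N K : ℕ}

/-- The entries of the diagonal matrix with diagonal `d`. -/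
def diagonalMean (d : Fin N → Fin K → ℂ) (s : (Fin N × Fin K) × (Fin N × Fin K)) : ℂ :=
  if s.1 = s.2 then d s.1.1 s.1.2 else 0

/-- The coefficients of the linear map `H ↦ -(H ⊗ 1)`. -/
def leftCoeff (s : (Fin N × Fin K) × (Fin N × Fin K)) (p q : Fin N) : ℂ :=
  if s.1.2 = s.2.2 then if s.1.1 = p then if s.2.1 = q then -1 else 0 else 0 else 0

/-- The coefficients of the linear map `S ↦ i (1 ⊗ S)`. -/
noncomputable def rightCoeff (s : (Fin N × Fin K) × (Fin N × Fin K)) (p q : Fin K) : ℂ :=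
  if s.1.1 = s.2.1 then if s.1.2 = p then if s.2.2 = q then Complex.I else 0 else 0 else 0

theorem sum_leftCoeff_smul {R : Type*} [AddCommGroup R] [Module ℂ R]
    (F : (Fin N × Fin K) × (Fin N × Fin K) → R) (p q : Fin N) :
    ∑ s, leftCoeff s p q • F s = -∑ a, F ((p, a), (q, a)) := by
  simp [leftCoeff, Fintype.sum_prod_type, ite_smul]

theorem sum_rightCoeff_smul {R : Type*} [AddCommGroup R] [Module ℂ R]
    (F : (Fin N × Fin K) × (Fin N × Fin K) → R) (p q : Fin K) :
    ∑ s, rightCoeff s p q • F s = Complex.I • ∑ i, F ((i, p), (i, q)) := by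
  simp [rightCoeff, Fintype.sum_prod_type, ite_smul, Finset.smul_sum]

/-- Factors the operator into products of two first order ones, so that each embedding reduces to a
partial trace of derivatives. -/
theorem secondOrder_of_coeff {σ : Type*} [Fintype σ] {k : ℕ} (c : ℂ)
    (a : σ → Fin k → Fin k → ℂ) (P : MvPolynomial σ ℂ) :
    secondOrder (fun s t => c * ∑ i, ∑ j, a s i j * a t j i) P =
      c • ∑ i, ∑ j, ∑ s, a s i j • ∑ t, a t j i • pderiv s (pderiv t P) := by
  rw [secondOrder_apply]
  simp only [mul_smul, Finset.sum_smul, Finset.smul_sum]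
  rw [Finset.sum_congr rfl fun s _ => Finset.sum_comm]
  rw [Finset.sum_comm]
  refine Finset.sum_congr rfl fun i _ => ?_
  rw [Finset.sum_congr rfl fun s _ => Finset.sum_comm]
  rw [Finset.sum_comm]

/-- The two covariance operators agree on the determinant. -/
theorem secondOrder_det_eq (c : ℂ) :
    secondOrder (fun s t => c * ∑ i, ∑ j, leftCoeff s i j * leftCoeff t j i)
        (mvPolynomialX (Fin N × Fin K) (Fin N × Fin K) ℂ).det =
      secondOrder (fun s t => c * ∑ i, ∑ j, rightCoeff s i j * rightCoeff t j i)
        (mvPolynomialX (Fin N × Fin K) (Fin N × Fin K) ℂ).det := by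
  rw [secondOrder_of_coeff, secondOrder_of_coeff]
  simp only [sum_leftCoeff_smul, sum_rightCoeff_smul]
  congr 1
  simp only [Finset.sum_neg_distrib, neg_neg, ← Finset.smul_sum, smul_smul, Complex.I_mul_I,
    neg_smul, one_smul]
  simp only [← Finset.sum_neg_distrib]
  -- Exchanging columns (q, a) and (p, b) turns derivatives diagonal in the second index into
  -- derivatives diagonal in the first; the sign is that of I * I on the other side.
  have hl : ∀ p q : Fin N, ∀ a b : Fin K,
      pderiv ((p, a), (q, a)) (pderiv ((q, b), (p, b))
        (mvPolynomialX (Fin N × Fin K) (Fin N × Fin K) ℂ).det) =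
      -pderiv ((p, a), (p, b)) (pderiv ((q, b), (q, a))
        (mvPolynomialX (Fin N × Fin K) (Fin N × Fin K) ℂ).det) :=
    fun p q a b => pderiv_pderiv_det_swap _ _ _ _
  simp only [hl]
  rw [Finset.sum_congr rfl fun p _ => Finset.sum_comm, Finset.sum_comm]
  refine Finset.sum_congr rfl fun a _ => ?_
  rw [Finset.sum_congr rfl fun p _ => Finset.sum_comm, Finset.sum_comm]

theorem eval_det_leftCoeff (d : Fin N → Fin K → ℂ) (x : HermitianEntries N) :
    eval (affineForm (diagonalMean d) leftCoeff x)
        (mvPolynomialX (Fin N × Fin K) (Fin N × Fin K) ℂ).det =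
      ∏ a, (diagonal (fun i => d i a) - (hermitianOfEntries x).1).det := by
  rw [eval_det_mvPolynomialX, ← det_blockDiagonal]
  congr 1
  ext ⟨i, a⟩ ⟨j, b⟩
  by_cases hab : a = b
  · subst hab
    by_cases hij : i = j <;>
      simp [affineForm, diagonalMean, leftCoeff, blockDiagonal_apply, hij,
        sub_eq_add_neg]
  · simp [affineForm, diagonalMean, leftCoeff, blockDiagonal_apply, hab]

theorem eval_det_rightCoeff (d : Fin N → Fin K → ℂ) (y : HermitianEntries K) :
    eval (affineForm (diagonalMean d) rightCoeff y)
        (mvPolynomialX (Fin N × Fin K) (Fin N × Fin K) ℂ).det =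
      ∏ i, (diagonal (d i) + Complex.I • (hermitianOfEntries y).1).det := by
  rw [eval_det_mvPolynomialX, ← det_blockDiagonal,
    -- `blockDiagonal` takes its block label as second index, so the tensor factors are swapped
    -- first.
    ← det_submatrix_equiv_self (Equiv.prodComm (Fin N) (Fin K))]
  congr 1
  ext ⟨i, a⟩ ⟨j, b⟩
  by_cases hij : i = j
  · subst hij
    by_cases hab : a = b <;>
      simp [affineForm, diagonalMean, rightCoeff, blockDiagonal_apply, hab]
  · simp [affineForm, diagonalMean, rightCoeff, blockDiagonal_apply, hij]

theorem gaussianFunctional_one {σ : Type*} {k : ℕ} {b : ℝ} (hb : 0 < b) (m : σ → ℂ)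
    (a : σ → Fin k → Fin k → ℂ) : gaussianFunctional hb m a 1 =
      ((∫ x : HermitianEntries k, Real.exp (-b * entriesNormSq x) : ℝ) : ℂ) := by
  rw [gaussianFunctional_apply, ← integral_complex_ofReal]
  simp

theorem integral_exp_pos {k : ℕ} {b : ℝ} (hb : 0 < b) :
    0 < ∫ x : HermitianEntries k, Real.exp (-b * entriesNormSq x) := by
  rw [integral_exp_neg_mul_entriesNormSq hb]
  positivity

/-- Duality between Gaussian averages over `N × N` and over `K × K` Hermitian matrices. -/
theorem gaussian_duality {b : ℝ} (hb : 0 < b) (d : Fin N → Fin K → ℂ) :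
    ((∫ x : HermitianEntries N, Real.exp (-b * entriesNormSq x) : ℝ) : ℂ)⁻¹ *
      ∫ x : HermitianEntries N, (∏ a, (diagonal (fun i => d i a) - (hermitianOfEntries x).1).det) *
        (Real.exp (-b * entriesNormSq x) : ℂ) =
    ((∫ y : HermitianEntries K, Real.exp (-b * entriesNormSq y) : ℝ) : ℂ)⁻¹ *
      ∫ y : HermitianEntries K, (∏ i, (diagonal (d i) + Complex.I • (hermitianOfEntries y).1).det) *
        (Real.exp (-b * entriesNormSq y) : ℂ) := by
  have hN : ((∫ x : HermitianEntries N, Real.exp (-b * entriesNormSq x) : ℝ) : ℂ) ≠ 0 :=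
    Complex.ofReal_ne_zero.mpr (integral_exp_pos hb).ne'
  have hK : ((∫ x : HermitianEntries K, Real.exp (-b * entriesNormSq x) : ℝ) : ℂ) ≠ 0 :=
    Complex.ofReal_ne_zero.mpr (integral_exp_pos hb).ne'
  -- Wick's rule is linear in the functional, so each one may be normalised to take the value 1 at
  -- 1.
  have scale : ∀ {k : ℕ} (c : ℂ) (a : (Fin N × Fin K) × (Fin N × Fin K) → Fin k → Fin k → ℂ)
      (s : (Fin N × Fin K) × (Fin N × Fin K)) (P : MvPolynomial _ ℂ),
      (c • gaussianFunctional hb (diagonalMean d) a) (X s * P) =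
        diagonalMean d s * (c • gaussianFunctional hb (diagonalMean d) a) P +
        ∑ t, ((2 * b : ℂ)⁻¹ * ∑ i, ∑ j, a s i j * a t j i) *
          (c • gaussianFunctional hb (diagonalMean d) a) (pderiv t P) := by
    intro k c a s P
    simp only [LinearMap.smul_apply, gaussianFunctional_X_mul, smul_eq_mul, mul_add]
    rw [Finset.mul_sum]
    exact congrArg₂ _ (by ring) (Finset.sum_congr rfl fun t _ => by ring)
  have h := wick_eq_of_secondOrder_eq (d := Fintype.card (Fin N × Fin K)) (by
      rw [LinearMap.smul_apply, LinearMap.smul_apply, gaussianFunctional_one,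
        gaussianFunctional_one, smul_eq_mul, smul_eq_mul, inv_mul_cancel₀ hN, inv_mul_cancel₀ hK])
    (scale ((∫ x : HermitianEntries N, Real.exp (-b * entriesNormSq x) : ℝ) : ℂ)⁻¹ leftCoeff)
    (scale ((∫ x : HermitianEntries K, Real.exp (-b * entriesNormSq x) : ℝ) : ℂ)⁻¹ rightCoeff)
    isHomogeneous_det_mvPolynomialX (secondOrder_det_eq _)
  simpa only [LinearMap.smul_apply, gaussianFunctional_apply, smul_eq_mul, eval_det_leftCoeff,
    eval_det_rightCoeff] using h

theorem integrable_prod_det_left {b : ℝ} (hb : 0 < b) (d : Fin N → Fin K → ℂ) :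
    Integrable fun x : HermitianEntries N =>
      (∏ a, (diagonal (fun i => d i a) - (hermitianOfEntries x).1).det) *
        (Real.exp (-b * entriesNormSq x) : ℂ) := by
  simpa only [eval_det_leftCoeff] using integrable_eval hb (diagonalMean d) leftCoeff
    (mvPolynomialX (Fin N × Fin K) (Fin N × Fin K) ℂ).det

theorem integrable_prod_det_right {b : ℝ} (hb : 0 < b) (d : Fin N → Fin K → ℂ) :
    Integrable fun y : HermitianEntries K =>
      (∏ i, (diagonal (d i) + Complex.I • (hermitianOfEntries y).1).det) *
        (Real.exp (-b * entriesNormSq y) : ℂ) := by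
  simpa only [eval_det_rightCoeff] using integrable_eval hb (diagonalMean d) rightCoeff
    (mvPolynomialX (Fin N × Fin K) (Fin N × Fin K) ℂ).det

end Duality

/-! ### Specialisation to the deformed GUE -/

section Deformation

open Matrix

variable {N M n : ℕ}

/-- The diagonal entries of `Z - i γ L`, with `γ` continued by zero beyond the index `M`. -/
noncomputable def shiftedSource (N : ℕ) (γ : Fin M → ℝ) (z : Fin n → ℂ) (i : Fin N) :
    Fin (n + n) → ℂ :=
  Fin.append (fun j => z j - Complex.I * (if h : (i : ℕ) < M then (γ ⟨i, h⟩ : ℂ) else 0))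
    (fun j => star (z j) + Complex.I * (if h : (i : ℕ) < M then (γ ⟨i, h⟩ : ℂ) else 0))

/-- Since H is Hermitian and γ real, the factors from the last n values of a are determinants of the
adjoints of the first n, and each pair multiplies to a squared modulus. -/
theorem ofReal_charPolyProduct (γ : Fin M → ℝ) (z : Fin n → ℂ) (H : HermitianMatrix N) :
    (charPolyProduct γ z H : ℂ) =
      ∏ a, (diagonal (fun i => shiftedSource N γ z i a) - H.1).det := by
  rw [Fin.prod_univ_add, ← Finset.prod_mul_distrib, charPolyProduct, Complex.ofReal_prod]
  refine Finset.prod_congr rfl fun j _ => ?_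
  have h1 : diagonal (fun i => shiftedSource N γ z i (Fin.castAdd n j)) - H.1 =
      z j • (1 : Matrix (Fin N) (Fin N) ℂ) - H.1 - Complex.I • deformation N γ := by
    ext a b
    by_cases hab : a = b
    · subst hab; simp [shiftedSource, deformation]; ring
    · simp [deformation, hab]
  have h2 : diagonal (fun i => shiftedSource N γ z i (Fin.natAdd n j)) - H.1 =
      (z j • (1 : Matrix (Fin N) (Fin N) ℂ) - H.1 - Complex.I • deformation N γ)ᴴ := by
    rw [conjTranspose_sub, conjTranspose_sub, H.2]
    ext a b
    by_cases hab : a = b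
    · subst hab
      by_cases h : (a : ℕ) < M <;> simp [shiftedSource, deformation, h, -Fin.natAdd_eq_addNat]
      ring
    · simp [deformation, hab]
  rw [h1, h2, det_conjTranspose, Complex.ofReal_pow]
  exact (Complex.mul_conj' _).symm

/-- Indices i beyond M carry no shift and produce the power N - M, a true difference because M ≤ N.
-/
theorem dualIntegrand_eq (hMN : M ≤ N) (γ : Fin M → ℝ) (z : Fin n → ℂ)
    (S : HermitianMatrix (n + n)) :
    dualIntegrand N γ z S = (∏ i, (diagonal (shiftedSource N γ z i) + Complex.I • S.1).det) *
      (Real.exp (gaussianExponent N S) : ℂ) := by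
  obtain ⟨r, rfl⟩ := Nat.exists_eq_add_of_le hMN
  have h1 : ∀ i : Fin M, diagonal (shiftedSource (M + r) γ z (Fin.castAdd r i)) + Complex.I • S.1 =
      Zmat z + Complex.I • S.1 - (Complex.I * (γ i : ℂ)) • Lmat n := by
    intro i
    have : diagonal (shiftedSource (M + r) γ z (Fin.castAdd r i)) =
        Zmat z - (Complex.I * (γ i : ℂ)) • Lmat n := by
      rw [Zmat, Lmat, ← diagonal_smul, diagonal_sub]
      congr 1
      funext a
      refine Fin.addCases (fun j => ?_) (fun j => ?_) a <;>
        simp [shiftedSource, -Fin.natAdd_eq_addNat]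
    rw [this]; abel
  have h2 : ∀ i : Fin r, diagonal (shiftedSource (M + r) γ z (Fin.natAdd M i)) = Zmat z := by
    intro i
    simp [shiftedSource, Zmat]
  rw [Fin.prod_univ_add, dualIntegrand]
  simp only [h1, h2, Finset.prod_const, Finset.card_univ, Fintype.card_fin,
    Nat.add_sub_cancel_left]
  ring

theorem continuous_gaussianExponent (N k : ℕ) : Continuous (gaussianExponent N (k := k)) := by
  unfold gaussianExponent
  have : Continuous fun S : HermitianMatrix k => trace (S.1 ^ 2) :=
    (continuous_subtype_val.pow 2).matrix_trace
  fun_prop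

theorem continuous_charPolyProduct (γ : Fin M → ℝ) (z : Fin n → ℂ) :
    Continuous (charPolyProduct (N := N) γ z) := by
  unfold charPolyProduct
  refine continuous_finsetProd _ fun j _ => ((Continuous.matrix_det ?_).norm).pow 2
  exact (continuous_const.sub continuous_subtype_val).sub continuous_const

theorem continuous_dualIntegrand (γ : Fin M → ℝ) (z : Fin n → ℂ) :
    Continuous (dualIntegrand N γ z) := by
  unfold dualIntegrand
  have hS : Continuous fun S : HermitianMatrix (n + n) => Zmat z + Complex.I • S.1 :=
    continuous_const.add (continuous_subtype_val.const_smul Complex.I)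
  refine ((Complex.continuous_ofReal.comp (Real.continuous_exp.comp
    (continuous_gaussianExponent N _))).mul (hS.matrix_det.pow _)).mul ?_
  exact continuous_finsetProd _ fun j _ => (hS.sub continuous_const).matrix_det

theorem integrable_hermitianVolume_iff {k : ℕ} {F : Type*} [NormedAddCommGroup F]
    [SecondCountableTopology F] {f : HermitianMatrix k → F} (hf : Continuous f) :
    Integrable f (hermitianVolume k) ↔
      Integrable (fun x : HermitianEntries k => f (hermitianOfEntries x)) :=
  integrable_map_measure hf.aestronglyMeasurable (measurable_hermitianOfEntries k).aemeasurable

theorem integral_hermitianVolume {k : ℕ} {F : Type*} [NormedAddCommGroup F] [NormedSpace ℝ F]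
    [SecondCountableTopology F] {f : HermitianMatrix k → F} (hf : Continuous f) :
    ∫ S, f S ∂hermitianVolume k = ∫ x : HermitianEntries k, f (hermitianOfEntries x) :=
  integral_map (measurable_hermitianOfEntries k).aemeasurable hf.aestronglyMeasurable

/-- Needed for the tilted measure to be a probability measure; the Gaussian integral is positive, so
the volume is not zero. -/
instance neZero_hermitianVolume (k : ℕ) : NeZero (hermitianVolume k) := by
  refine ⟨fun h => ?_⟩
  have h0 : (volume : Measure (HermitianEntries k)) = 0 :=
    (Measure.map_eq_zero_iff (measurable_hermitianOfEntries k).aemeasurable).mp h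
  have hpos := integral_exp_pos (k := k) one_pos
  rw [h0] at hpos
  simp at hpos

/-- The 2n diagonal entries give (2π/N)^n and the n(2n - 1) complex entries give π/N each, so the
exponent of π/N is n + n(2n - 1) = 2n². -/
theorem integral_exp_double (n : ℕ) {N : ℕ} (hN : 0 < N) :
    ∫ x : HermitianEntries (n + n), Real.exp (-((N : ℝ) / 2) * entriesNormSq x) =
      2 ^ n * (Real.pi / N) ^ (2 * n ^ 2) := by
  have hN' : (0 : ℝ) < N := Nat.cast_pos.mpr hN
  have hc := two_mul_card_lt (n + n)
  rw [integral_exp_neg_mul_entriesNormSq (by positivity)]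
  have h1 : √(Real.pi / ((N : ℝ) / 2)) ^ (n + n) = 2 ^ n * (Real.pi / N) ^ n := by
    rw [← two_mul, pow_mul, Real.sq_sqrt (by positivity), ← mul_pow]
    congr 1
    field_simp
  rw [h1, mul_div_cancel₀ _ two_ne_zero, mul_assoc, ← pow_add]
  congr 2
  nlinarith

end Deformation

end GUEDuality

/-! ### The duality formula -/

theorem proposition4p1 (N M n : ℕ) (hN : 0 < N) (hMN : M ≤ N)
    (γ : Fin M → ℝ) (z : Fin n → ℂ) :
    MeasureTheory.IsProbabilityMeasure (GUEDuality.gue N) ∧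
    MeasureTheory.Integrable (fun H => GUEDuality.charPolyProduct γ z H) (GUEDuality.gue N) ∧
    MeasureTheory.Integrable (fun S => GUEDuality.dualIntegrand N γ z S)
      (GUEDuality.hermitianVolume (n + n)) ∧
    ((∫ H, GUEDuality.charPolyProduct γ z H ∂(GUEDuality.gue N) : ℝ) : ℂ) =
      1 / 2 ^ n * ((N : ℂ) / (Real.pi : ℂ)) ^ (2 * n ^ 2) *
        ∫ S, GUEDuality.dualIntegrand N γ z S ∂(GUEDuality.hermitianVolume (n + n)) := by
  open GUEDuality in
  have hN' : (0 : ℝ) < N := Nat.cast_pos.mpr hN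
  have hb : (0 : ℝ) < (N : ℝ) / 2 := by positivity
  have hexpc : Continuous fun H : HermitianMatrix N => Real.exp (gaussianExponent N H) :=
    Real.continuous_exp.comp (continuous_gaussianExponent N N)
  have hexp : Integrable (fun H : HermitianMatrix N => Real.exp (gaussianExponent N H))
      (hermitianVolume N) := by
    rw [integrable_hermitianVolume_iff hexpc]
    simpa only [gaussianExponent_hermitianOfEntries] using integrable_exp_neg_mul_entriesNormSq hb
  have hchar : ∀ x : HermitianEntries N,
      ((Real.exp (gaussianExponent N (hermitianOfEntries x)) •
        charPolyProduct γ z (hermitianOfEntries x) : ℝ) : ℂ) =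
      (∏ a, (Matrix.diagonal (fun i => shiftedSource N γ z i a) - (hermitianOfEntries x).1).det) *
        (Real.exp (-((N : ℝ) / 2) * entriesNormSq x) : ℂ) := by
    intro x
    rw [smul_eq_mul, Complex.ofReal_mul, ofReal_charPolyProduct, mul_comm,
      gaussianExponent_hermitianOfEntries]
  have hdual : ∀ y : HermitianEntries (n + n), dualIntegrand N γ z (hermitianOfEntries y) =
      (∏ i, (Matrix.diagonal (shiftedSource N γ z i) +
        Complex.I • (hermitianOfEntries y).1).det) *
        (Real.exp (-((N : ℝ) / 2) * entriesNormSq y) : ℂ) := by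
    intro y
    rw [dualIntegrand_eq hMN, gaussianExponent_hermitianOfEntries]
  have hcharc : Continuous fun H : HermitianMatrix N =>
      Real.exp (gaussianExponent N H) • charPolyProduct γ z H :=
    hexpc.smul (continuous_charPolyProduct γ z)
  refine ⟨isProbabilityMeasure_tilted hexp, ?_, ?_, ?_⟩
  · rw [gue, integrable_tilted_iff hexp, integrable_hermitianVolume_iff hcharc]
    -- The integrand is the real part of the complex determinant product.
    have h := (integrable_prod_det_left hb (shiftedSource N γ z)).re
    simpa only [← hchar, RCLike.re_to_complex, Complex.ofReal_re] using h
  · rw [integrable_hermitianVolume_iff (continuous_dualIntegrand γ z)]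
    simpa only [hdual] using integrable_prod_det_right hb (shiftedSource N γ z)
  · rw [gue, integral_tilted, integral_hermitianVolume (continuous_dualIntegrand γ z)]
    have hZ : ∫ H : HermitianMatrix N, Real.exp (gaussianExponent N H) ∂hermitianVolume N =
        ∫ x : HermitianEntries N, Real.exp (-((N : ℝ) / 2) * entriesNormSq x) := by
      rw [integral_hermitianVolume hexpc]
      simp only [gaussianExponent_hermitianOfEntries]
    have hdu := gaussian_duality hb (shiftedSource N γ z)
    simp only [← hdual, ← hchar] at hdu
    rw [integral_exp_double n hN, integral_complex_ofReal] at hdu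
    simp only [div_eq_inv_mul (Real.exp _), smul_eq_mul, mul_assoc (_⁻¹ : ℝ), integral_const_mul]
    rw [hZ, Complex.ofReal_mul, Complex.ofReal_inv]
    have hI := integral_hermitianVolume hcharc
    simp only [smul_eq_mul] at hI hdu
    rw [hI, hdu]
    congr 1
    push_cast
    rw [mul_inv, ← inv_pow (_ / _ : ℂ), inv_div, one_div]
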